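/- Let $p$ be an odd prime. For elements $\sigma,\tau$ of a group put $[\sigma,\tau]={}^1[\sigma,\tau]=\sigma\tau\sigma^{-1}\tau^{-1}$ and ${}^n[\sigma,\tau]=[\sigma,{}^{n-1}[\sigma,\tau]]$ for $n\ge 2$. Let $\mathcal I$ be a (possibly infinite) index set not containing $1,2$, and let $\Gamma$ be a pro-$p$-group minimally generated by a family $\{\sigma_1,\sigma_2\}\cup\{\sigma_i\}_{i\in\mathcal I}$ (converging to $1$ if $\mathcal I$ is infinite) subject to the single relation $$\sigma_1^q\cdot{}^f[\sigma_1,\sigma_2]\cdot\prod_{(i,j)\in\mathcal J}[\sigma_i,\sigma_j]\cdot\prod_{k\in\mathcal K}[\sigma_1^p,\sigma_k]=1,$$ that is, $\Gamma$ is the quotient of the free pro-$p$-group on these generators by the closed normal subgroup generated by the left-hand side. Here $2\le f\le p-1$, $q\ge 0$ is an integer divisible by $p^2$ (possibly $q=0$), $\mathcal J\subset\mathcal I\times\mathcal I$ is a finite ordered set of pairs, and $\mathcal K\subset\mathcal I$ is a finite ordered subset. Then $\Gamma$ is not an absolute Galois group: there is no field $F$ whose absolute Galois group is isomorphic to $\Gamma$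 as a topological group. -/

import Mathlib

open scoped commutatorElement

/-- The iterated commutators `ⁿ[σ, τ]`: `⁰[σ, τ] = τ` and `ⁿ⁺¹[σ, τ] = [σ, ⁿ[σ, τ]]`,
where `[a, b] = a b a⁻¹ b⁻¹`. -/
def iteratedCommutator {G : Type*} [Group G] (σ τ : G) : ℕ → G
  | 0 => τ
  | n + 1 => ⁅σ, iteratedCommutator σ τ n⁆

/-- The word `σ₁^q · ᶠ[σ₁, σ₂] · ∏_{(i,j) ∈ J} [σ_i, σ_j] · ∏_{k ∈ K} [σ₁^p, σ_k]` in a group,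
the two products being taken in the order of the lists `J` and `K`.
The generators `σ₁, σ₂` are `s (.inl 0), s (.inl 1)`, and `σ_i` is `s (.inr i)` for `i : I`. -/
def demushkinLikeWord {G : Type*} [Group G] {I : Type*} (s : Fin 2 ⊕ I → G)
    (p q f : ℕ) (J : List (I × I)) (K : List I) : G :=
  s (.inl 0) ^ q * iteratedCommutator (s (.inl 0)) (s (.inl 1)) f *
    (J.map fun ij => ⁅s (.inr ij.1), s (.inr ij.2)⁆).prod *
    (K.map fun k => ⁅s (.inl 0) ^ p, s (.inr k)⁆).prod

/-- A pro-`p`-group: a profinite group (compact, Hausdorff, totally disconnected) all of whose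
quotients by open normal subgroups are `p`-groups. -/
structure IsProP (p : ℕ) (Γ : Type*) [Group Γ] [TopologicalSpace Γ] [IsTopologicalGroup Γ] :
    Prop where
  compactSpace : CompactSpace Γ
  t2Space : T2Space Γ
  totallyDisconnectedSpace : TotallyDisconnectedSpace Γ
  isPGroup_quotient : ∀ U : Subgroup Γ, [U.Normal] → IsOpen (U : Set Γ) → IsPGroup p (Γ ⧸ U)

/-- The family `s` minimally generates the topological group `Γ`: it converges to `1`, it
generates a dense subgroup, and no proper subfamily generates a dense subgroup. -/
structure MinimallyGenerates {X Γ : Type*} [Group Γ] [TopologicalSpace Γ] [IsTopologicalGroup Γ]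
    (s : X → Γ) : Prop where
  tendsto_one : Filter.Tendsto s Filter.cofinite (nhds 1)
  generates : (Subgroup.closure (Set.range s)).topologicalClosure = ⊤
  minimal : ∀ x, (Subgroup.closure (s '' {x}ᶜ)).topologicalClosure ≠ ⊤

/-- The normal subgroups of `p`-power index of the free group on `X` that contain all but
finitely many of the elements of the basis `X`. -/
def FreeProPIndex (p : ℕ) (X : Type*) :=
  {N : Subgroup (FreeGroup X) //
    N.Normal ∧ (∃ n : ℕ, N.index = p ^ n) ∧ {x | FreeGroup.of x ∉ N}.Finite}

/-- The finite quotient of the free group by a member of `FreeProPIndex`. -/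
def FreeProPLevel {p : ℕ} {X : Type*} (N : FreeProPIndex p X) := FreeGroup X ⧸ N.1

noncomputable instance FreeProPLevel.instGroup {p : ℕ} {X : Type*} (N : FreeProPIndex p X) :
    Group (FreeProPLevel N) :=
  haveI := N.2.1
  inferInstanceAs (Group (FreeGroup X ⧸ N.1))

instance FreeProPLevel.instTopologicalSpace {p : ℕ} {X : Type*} (N : FreeProPIndex p X) :
    TopologicalSpace (FreeProPLevel N) := ⊥

instance FreeProPLevel.instDiscreteTopology {p : ℕ} {X : Type*} (N : FreeProPIndex p X) :
    DiscreteTopology (FreeProPLevel N) := ⟨rfl⟩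

/-- The projection of the free group to a finite quotient. -/
noncomputable def FreeProPLevel.mk {p : ℕ} {X : Type*} (N : FreeProPIndex p X) :
    FreeGroup X →* FreeProPLevel N :=
  haveI := N.2.1
  QuotientGroup.mk' N.1

/-- The transition map between two finite quotients. -/
noncomputable def FreeProPLevel.map {p : ℕ} {X : Type*} {M N : FreeProPIndex p X}
    (h : M.1 ≤ N.1) : FreeProPLevel M →* FreeProPLevel N :=
  haveI := M.2.1
  haveI := N.2.1
  QuotientGroup.map M.1 N.1 (MonoidHom.id _) h

/-- The free pro-`p`-group on the set `X` (converging to `1`): the inverse limit, in the product of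
the discrete groups `FreeGroup X ⧸ N`, over the normal subgroups `N` of `p`-power index that
contain all but finitely many elements of `X`. -/
def FreeProP (p : ℕ) (X : Type*) : Subgroup (∀ N : FreeProPIndex p X, FreeProPLevel N) where
  carrier := {g | ∀ (M N : FreeProPIndex p X) (h : M.1 ≤ N.1), FreeProPLevel.map h (g M) = g N}
  mul_mem' := fun ha hb M N h => by simp [ha M N h, hb M N h]
  one_mem' := fun M N h => by simp
  inv_mem' := fun ha M N h => by simp [ha M N h]

/-- The canonical basis of the free pro-`p`-group. -/
noncomputable def FreeProP.of {p : ℕ} {X : Type*} (x : X) : FreeProP p X :=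
  ⟨fun N => FreeProPLevel.mk N (FreeGroup.of x), fun _ _ _ => rfl⟩

/-- The group `Γ`, with generators `s`, is defined as a pro-`p`-group by the single relation
`r = 1`: the map sending the canonical basis to `s` extends to a continuous surjection from the
free pro-`p`-group whose kernel is the closed normal subgroup generated by `r`. -/
def IsOneRelatorProP (p : ℕ) {X Γ : Type*} [Group Γ] [TopologicalSpace Γ]
    (s : X → Γ) (r : FreeProP p X) : Prop :=
  ∃ π : FreeProP p X →* Γ, Continuous π ∧ Function.Surjective π ∧
    (∀ x, π (FreeProP.of x) = s x) ∧
    π.ker = (Subgroup.normalClosure {r}).topologicalClosure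

/-! Suppose `Γ` is the absolute Galois group of `F`. Sending `σ₁, σ₂` to the standard generators of
the Heisenberg group mod `p` and the other generators to `1` respects the relation, because that
group has class two and `2 ≤ f`. Let `H` be the kernel of the first coordinate. On `H` the corner
entry is a character `χ` of order `p`.

Galois theory lifts `χ` to a cocycle `c : H → ℤ/p²`, twisted by a character `θ ≡ 1` mod `p`: by
Kummer theory with `θ` cyclotomic (`exists_lift_of_natCast_ne_zero`), or in characteristic `p` by
Witt vectors with `θ = 1` (`exists_lift_of_charP`).

The relation forbids this lift (`not_isTwistedHom_of_relation`). Put `Y b = c (σ₁ᵇ σ₂ σ₁⁻ᵇ)`, so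
that `Y b ≡ b` mod `p`. Conjugating the relation by `σ₁ᵇ` and applying `c` kills every factor except
the iterated commutator, which gives the `f`-th difference of `Y`; hence that difference is `0`. As
`f < p`, Newton's formula yields `Y p - Y 0 = p ≠ 0`. But `σ₁ᵖ ∈ H` and `c (σ₁ᵖ) ≡ 0` mod `p`, which
forces `Y p = Y 0`. -/

/-! ### Finite differences modulo `p²`. -/

section ReductionModSquare

variable {p : ℕ}

/-- The reduction `ℤ/p² → ℤ/p`. -/
def redModSq (p : ℕ) : ZMod (p ^ 2) →+* ZMod p :=
  ZMod.castHom (dvd_pow_self p two_ne_zero) (ZMod p)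

theorem exists_eq_mul_of_redModSq_eq_zero [Fact p.Prime] {a : ZMod (p ^ 2)}
    (ha : redModSq p a = 0) : ∃ u, a = p * u := by
  have : NeZero (p ^ 2) := ⟨pow_ne_zero _ (Fact.out : p.Prime).ne_zero⟩
  have h : ((a.val : ℕ) : ZMod p) = 0 := by
    rw [← ha, ← map_natCast (redModSq p), ZMod.natCast_zmod_val]
  obtain ⟨k, hk⟩ := (ZMod.natCast_eq_zero_iff _ _).1 h
  refine ⟨k, ?_⟩
  rw [← ZMod.natCast_zmod_val a, hk]
  push_cast
  rfl

theorem natCast_mul_self_modSq (p : ℕ) : (p : ZMod (p ^ 2)) * p = 0 := by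
  rw [← Nat.cast_mul, ← sq, ZMod.natCast_self]

theorem mul_eq_zero_of_redModSq [Fact p.Prime] {a b : ZMod (p ^ 2)}
    (ha : redModSq p a = 0) (hb : redModSq p b = 0) : a * b = 0 := by
  obtain ⟨u, rfl⟩ := exists_eq_mul_of_redModSq_eq_zero ha
  obtain ⟨v, rfl⟩ := exists_eq_mul_of_redModSq_eq_zero hb
  linear_combination (u * v) * natCast_mul_self_modSq p

theorem redModSq_fwdDiff_iter (Y : ℕ → ZMod (p ^ 2)) (n b : ℕ) :
    redModSq p ((fwdDiff 1)^[n] Y b) = (fwdDiff 1)^[n] (fun b => redModSq p (Y b)) b := by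
  induction n generalizing Y with
  | zero => rfl
  | succ n ih =>
    rw [Function.iterate_succ_apply, Function.iterate_succ_apply, ih]
    have h : (fun b => redModSq p (fwdDiff 1 Y b)) = fwdDiff 1 fun b => redModSq p (Y b) := by
      funext b
      simp [fwdDiff]
    rw [h]

theorem fwdDiff_iter_add_two_natCast (R : Type*) [CommRing R] (n : ℕ) :
    (fwdDiff 1)^[n + 2] (fun b : ℕ => (b : R)) = 0 := by
  have h : fwdDiff 1 (fwdDiff 1 (fun b : ℕ => (b : R))) = 0 := by
    ext b; simp [fwdDiff]
  rw [Function.iterate_add_apply]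
  simp only [Function.iterate_succ_apply, Function.iterate_zero, id, h]
  induction n with
  | zero => rfl
  | succ n ih =>
    rw [Function.iterate_succ_apply]
    convert ih using 2
    ext b; simp [fwdDiff]

/-- A polynomial sequence of degree `< p` in `ℤ/p²` that is `b ↦ b` modulo `p` is not
`p`-periodic. -/
theorem apply_prime_ne_apply_zero [Fact p.Prime] {Y : ℕ → ZMod (p ^ 2)} {f : ℕ}
    (hfp : f < p) (hY : ∀ b, redModSq p (Y b) = b) (hf : ∀ b, (fwdDiff 1)^[f] Y b = 0) :
    Y p ≠ Y 0 := by
  intro h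
  have hp : p.Prime := Fact.out
  have hvanish : ∀ n, f ≤ n → (fwdDiff 1)^[n] Y 0 = 0 := by
    intro n hn
    obtain ⟨m, rfl⟩ := Nat.exists_eq_add_of_le hn
    have h0 : (fwdDiff 1)^[f] Y = 0 := funext hf
    rw [add_comm, Function.iterate_add_apply, h0]
    clear hn
    induction m with
    | zero => rfl
    | succ m ih =>
      rw [Function.iterate_succ_apply]
      convert ih using 2
      ext b; simp [fwdDiff]
  -- Newton's formula `Y p = ∑ₖ C(p, k) Δᵏ Y 0`. Once `k = 0` is split off, indices shift by one:
  -- index `0` is now the term `p · ΔY 0`, which equals `p` because `ΔY 0 ≡ 1` mod `p`.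
  have key := shift_eq_sum_fwdDiff_iter 1 Y p 0
  rw [Finset.sum_range_succ', Finset.sum_eq_single_of_mem 0 (Finset.mem_range.2 hp.pos)] at key
  · simp only [zero_add, nsmul_eq_mul, smul_eq_mul, mul_one, Nat.choose_one_right,
      Function.iterate_one, Nat.choose_zero_right, Nat.cast_one, one_mul, Function.iterate_zero,
      id] at key
    have h1 : (p : ZMod (p ^ 2)) * fwdDiff 1 Y 0 = 0 := by linear_combination h - key
    have h2 : redModSq p (fwdDiff 1 Y 0 - 1) = 0 := by simp [fwdDiff, hY]
    obtain ⟨u, hu⟩ := exists_eq_mul_of_redModSq_eq_zero h2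
    have h3 : (p : ZMod (p ^ 2)) = 0 := by
      linear_combination h1 - p * hu - u * natCast_mul_self_modSq p
    have h4 := Nat.le_of_dvd hp.pos ((ZMod.natCast_eq_zero_iff _ _).1 h3)
    nlinarith [hp.two_le]
  · intro k hk hk0
    rw [nsmul_eq_mul]
    -- Below order `p` both the binomial coefficient and the difference are multiples of `p`; at
    -- order `p` the difference itself vanishes.
    rcases lt_or_ge (k + 1) p with hkp | hkp
    · refine mul_eq_zero_of_redModSq ?_ ?_
      · rw [map_natCast, ZMod.natCast_eq_zero_iff]
        exact hp.dvd_choose_self (Nat.succ_ne_zero k) hkp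
      · obtain ⟨m, rfl⟩ := Nat.exists_eq_succ_of_ne_zero hk0
        rw [redModSq_fwdDiff_iter]
        simp only [hY]
        exact congrFun (fwdDiff_iter_add_two_natCast _ m) 0
    · rw [hvanish _ (hfp.le.trans hkp), mul_zero]

end ReductionModSquare

/-! ### Cocycles twisted by a character. -/

section TwistedHom

variable {p : ℕ} {H : Type*} [Group H] {R : Type*} [CommRing R]

/-- `c : H → R` is a 1-cocycle for the action of `H` on `R` through the character `θ`. -/
def IsTwistedHom (θ : H →* R) (c : H → R) : Prop :=
  ∀ g h, c (g * h) = c g + θ g * c h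

namespace IsTwistedHom

variable {θ : H →* R} {c : H → R}

theorem map_one (hc : IsTwistedHom θ c) : c 1 = 0 := by
  have h := hc 1 1
  rw [mul_one, _root_.map_one] at h
  linear_combination -h

theorem map_mul_inv (hc : IsTwistedHom θ c) (g h : H) :
    c (g * h⁻¹) = c g - θ (g * h⁻¹) * c h := by
  have e := hc (g * h⁻¹) h
  rw [inv_mul_cancel_right] at e
  linear_combination -e

/-- Expand `c` on both sides of `g h = ⁅g, h⁆ (h g)`; `θ` is trivial on commutators since `R` is
commutative. -/
theorem map_commutator (hc : IsTwistedHom θ c) (g h : H) :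
    c ⁅g, h⁆ = (1 - θ h) * c g + (θ g - 1) * c h := by
  have hθ : θ ⁅g, h⁆ = 1 := by
    have e : θ ⁅g, h⁆ * θ (h * g) = θ (h * g) := by
      rw [← map_mul]
      rw [commutatorElement_def, show g * h * g⁻¹ * h⁻¹ * (h * g) = g * h by group, map_mul, map_mul, mul_comm]
    calc θ ⁅g, h⁆ = θ ⁅g, h⁆ * θ (h * g) * θ (h * g)⁻¹ := by
          rw [mul_assoc, ← map_mul, mul_inv_cancel, _root_.map_one, mul_one]
      _ = 1 := by rw [e, ← map_mul, mul_inv_cancel, _root_.map_one]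
  have e := hc ⁅g, h⁆ (h * g)
  rw [commutatorElement_def, show g * h * g⁻¹ * h⁻¹ * (h * g) = g * h by group,
    ← commutatorElement_def, hθ, hc, hc] at e
  linear_combination -e

theorem map_list_prod_eq_zero (hc : IsTwistedHom θ c) {l : List H} (hl : ∀ g ∈ l, c g = 0) :
    c l.prod = 0 := by
  induction l with
  | nil => exact hc.map_one
  | cons a l ih =>
    rw [List.prod_cons, hc, hl a (by simp), ih fun g hg => hl g (by simp [hg])]
    simp

end IsTwistedHom

end TwistedHom

/-! ### The relation obstructs lifting modulo `p²`. -/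

section Relation

variable {p : ℕ} {Γ I : Type*} [Group Γ]

theorem map_iteratedCommutator {G G' : Type*} [Group G] [Group G'] (φ : G →* G') (a b : G)
    (n : ℕ) : φ (iteratedCommutator a b n) = iteratedCommutator (φ a) (φ b) n := by
  induction n with
  | zero => rfl
  | succ n ih => simp [iteratedCommutator, map_commutatorElement, ih]

theorem map_demushkinLikeWord {G G' : Type*} [Group G] [Group G'] (φ : G →* G')
    (s : Fin 2 ⊕ I → G) (p q f : ℕ) (J : List (I × I)) (K : List I) :
    φ (demushkinLikeWord s p q f J K) = demushkinLikeWord (φ ∘ s) p q f J K := by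
  simp [demushkinLikeWord, map_iteratedCommutator, map_list_prod, Function.comp_def,
    map_commutatorElement]

theorem iteratedCommutator_mem (H : Subgroup Γ) [hH : H.Normal] {a b : Γ} (hb : b ∈ H) (n : ℕ) :
    iteratedCommutator a b n ∈ H := by
  induction n with
  | zero => exact hb
  | succ n ih => exact H.mul_mem (hH.conj_mem _ ih a) (H.inv_mem ih)

/-- There is no twisted homomorphism modulo `p²` on a suitable normal subgroup that takes the
values `b` modulo `p` at the conjugates `σ₁ᵇ σ₂ σ₁⁻ᵇ` and vanishes modulo `p` at `σ₁ᵖ` and at the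
conjugates of the other generators. -/
theorem not_isTwistedHom_of_relation [Fact p.Prime] {s : Fin 2 ⊕ I → Γ} {f q : ℕ}
    (hfp : f < p) (hq : p ^ 2 ∣ q) {J : List (I × I)} {K : List I}
    (hrel : demushkinLikeWord s p q f J K = 1)
    (H : Subgroup Γ) [hH : H.Normal] (h0 : s (.inl 0) ^ p ∈ H) (h1 : s (.inl 1) ∈ H)
    (hI : ∀ i, s (.inr i) ∈ H) {θ : Γ →* ZMod (p ^ 2)} (hθ : ∀ g, redModSq p (θ g) = 1)
    {c : H → ZMod (p ^ 2)} (hc : IsTwistedHom (θ.comp H.subtype) c)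
    (hc0 : redModSq p (c ⟨_, h0⟩) = 0)
    (hc1 : ∀ b : ℕ, redModSq p (c ⟨_, hH.conj_mem _ h1 (s (.inl 0) ^ b)⟩) = b)
    (hcI : ∀ i, ∀ b : ℕ, redModSq p (c ⟨_, hH.conj_mem _ (hI i) (s (.inl 0) ^ b)⟩) = 0) :
    False := by
  set a := s (.inl 0) with ha
  set x : H := ⟨_, h0⟩ with hx
  set z : I → ℕ → H := fun i b => ⟨_, hH.conj_mem _ (hI i) (a ^ b)⟩ with hz
  set w : ℕ → ℕ → H := fun n b =>
    ⟨_, hH.conj_mem _ (iteratedCommutator_mem H h1 (a := a) n) (a ^ b)⟩ with hw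
  -- A commutator with `σ₁` becomes a difference in the exponent `b`; `θ` is trivial on this
  -- quotient, so under `c` it is an untwisted forward difference.
  have hwsucc : ∀ n b, w (n + 1) b = w n (b + 1) * (w n b)⁻¹ := by
    intro n b
    ext
    simp only [hw, Subgroup.coe_mul, Subgroup.coe_inv, iteratedCommutator, commutatorElement_def]
    group
  have hθinv : ∀ g, θ g * θ g⁻¹ = 1 := fun g => by rw [← map_mul, mul_inv_cancel, map_one]
  have hθconj : ∀ g h, θ (g * h * g⁻¹) = θ h := fun g h => by
    rw [map_mul, map_mul]
    linear_combination θ h * hθinv g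
  have hθw : ∀ n b, θ.comp H.subtype (w n (b + 1) * (w n b)⁻¹) = 1 := by
    intro n b
    have e : ((w n (b + 1) * (w n b)⁻¹ : H) : Γ) =
        (a ^ (b + 1) * iteratedCommutator a (s (.inl 1)) n * (a ^ (b + 1))⁻¹) *
          (a ^ b * (iteratedCommutator a (s (.inl 1)) n)⁻¹ * (a ^ b)⁻¹) := by
      simp only [hw, Subgroup.coe_mul, Subgroup.coe_inv]
      group
    rw [MonoidHom.comp_apply, Subgroup.subtype_apply, e, map_mul, hθconj, hθconj, hθinv]
  have hcw : ∀ n b, c (w n b) = (fwdDiff 1)^[n] (fun b => c (w 0 b)) b := by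
    intro n
    induction n with
    | zero => intro b; rfl
    | succ n ih =>
      intro b
      rw [hwsucc, hc.map_mul_inv, hθw, Function.iterate_succ_apply', fwdDiff, ← ih, ← ih, one_mul]
  have hcomm : ∀ g h : H, redModSq p (c g) = 0 → redModSq p (c h) = 0 → c ⁅g, h⁆ = 0 := by
    intro g h hg hh
    rw [hc.map_commutator, mul_eq_zero_of_redModSq _ hg, mul_eq_zero_of_redModSq _ hh, add_zero]
    · simp [hθ]
    · simp [hθ]
  have hpow : ∀ n : ℕ, c (x ^ n) = n * c x := by
    intro n
    induction n with
    | zero => simp [hc.map_one]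
    | succ n ih =>
      have h : (θ.comp H.subtype (x ^ n) - 1) * c x = 0 :=
        mul_eq_zero_of_redModSq (by simp [hθ]) hc0
      rw [pow_succ x, hc, ih]
      push_cast
      linear_combination h
  have hY : ∀ b, (fwdDiff 1)^[f] (fun b => c (w 0 b)) b = 0 := by
    intro b
    obtain ⟨k, rfl⟩ := hq
    -- The relation conjugated by `σ₁ᵇ`, read inside `H`. Conjugation fixes `x = σ₁ᵖ`, and `σ₁^q` is
    -- a power of `xᵖ` because `p² ∣ q`, so `c` kills it.
    have hword : x ^ (p * k) * (w f b * (J.map fun ij => ⁅z ij.1 b, z ij.2 b⁆).prod *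
        (K.map fun k => ⁅x, z k b⁆).prod) = 1 := by
      apply H.subtype_injective
      have e : MulAut.conj (a ^ b) (demushkinLikeWord s p (p ^ 2 * k) f J K) = 1 := by
        rw [hrel, map_one]
      have ex : MulAut.conj (a ^ b) (a ^ p) = a ^ p := by
        rw [MulAut.conj_apply, ((Commute.refl a).pow_pow b p).eq, mul_inv_cancel_right]
      have ea : MulAut.conj (a ^ b) (a ^ (p ^ 2 * k)) = (a ^ p) ^ (p * k) := by
        rw [sq, mul_assoc, pow_mul, map_pow, ex]
      simp only [demushkinLikeWord, map_mul, map_list_prod, List.map_map, ← ha, ea] at e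
      simp only [map_mul, map_list_prod, List.map_map, map_one, map_pow]
      rw [← e]
      have eJ : J.map (H.subtype ∘ fun ij => ⁅z ij.1 b, z ij.2 b⁆) =
          J.map (MulAut.conj (a ^ b) ∘ fun ij => ⁅s (.inr ij.1), s (.inr ij.2)⁆) :=
        List.map_congr_left fun ij _ => by
          simp only [Function.comp_apply, map_commutatorElement]
          rfl
      have eK : K.map (H.subtype ∘ fun k => ⁅x, z k b⁆) =
          K.map (MulAut.conj (a ^ b) ∘ fun k => ⁅a ^ p, s (.inr k)⁆) :=
        List.map_congr_left fun k _ => by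
          simp only [Function.comp_apply, map_commutatorElement, ex]
          rfl
      rw [eJ, eK]
      simp only [mul_assoc]
      rfl
    have e := congrArg c hword
    rw [hc.map_one, mul_assoc, hc, hc, hc, hpow, Nat.cast_mul, mul_right_comm,
      mul_eq_zero_of_redModSq (by simp) hc0, hc.map_list_prod_eq_zero, hc.map_list_prod_eq_zero]
      at e
    · have h1 : θ.comp H.subtype (x ^ (p * k)) * θ.comp H.subtype (x ^ (p * k))⁻¹ = 1 := by
        rw [← map_mul, mul_inv_cancel, map_one]
      rw [← hcw]
      linear_combination θ.comp H.subtype (x ^ (p * k))⁻¹ * e - c (w f b) * h1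
    · simp only [List.mem_map]
      rintro _ ⟨k, -, rfl⟩
      exact hcomm _ _ hc0 (hcI _ _)
    · simp only [List.mem_map]
      rintro _ ⟨ij, -, rfl⟩
      exact hcomm _ _ (hcI _ _) (hcI _ _)
  refine apply_prime_ne_apply_zero hfp (Y := fun b => c (w 0 b)) hc1 hY ?_
  -- Conjugation by `x` does not change `c (w 0 0)`: the correction terms are products of two
  -- multiples of `p`, since both `c x` and `c (w 0 0)` vanish mod `p`.
  have hper : w 0 p = x * w 0 0 * x⁻¹ := by
    ext
    simp [hw, hx]
  have e2 := hc (w 0 p) x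
  have h1 : (1 - θ.comp H.subtype (w 0 p)) * c x = 0 :=
    mul_eq_zero_of_redModSq (by simp [hθ]) hc0
  have h2 : (θ.comp H.subtype x - 1) * c (w 0 0) = 0 :=
    mul_eq_zero_of_redModSq (by simp [hθ]) ((hc1 0).trans Nat.cast_zero)
  rw [hper, inv_mul_cancel_right, hc, ← hper] at e2
  linear_combination h1 - e2 + h2
end Relation

/-! ### Homomorphisms from `Γ` to finite `p`-groups. -/

section UniversalProperty

variable {p : ℕ} {X : Type*}

theorem FreeProPLevel.finite [Fact p.Prime] (N : FreeProPIndex p X) :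
    Finite (FreeProPLevel N) := by
  obtain ⟨n, hn⟩ := N.2.2.1
  have : N.1.FiniteIndex := ⟨by rw [hn]; exact pow_ne_zero _ (Fact.out : p.Prime).ne_zero⟩
  exact inferInstanceAs (Finite (FreeGroup X ⧸ N.1))

theorem FreeProP.compactSpace [Fact p.Prime] : CompactSpace (FreeProP p X) := by
  have : ∀ N : FreeProPIndex p X, Finite (FreeProPLevel N) := FreeProPLevel.finite
  apply isCompact_iff_compactSpace.1
  apply IsClosed.isCompact
  have h : ((FreeProP p X : Subgroup _) : Set (∀ N : FreeProPIndex p X, FreeProPLevel N)) =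
      ⋂ (M : FreeProPIndex p X) (N : FreeProPIndex p X) (h : M.1 ≤ N.1),
        {g | FreeProPLevel.map h (g M) = g N} := by
    ext g
    simp [FreeProP, Set.mem_iInter]
  rw [h]
  refine isClosed_iInter fun M => isClosed_iInter fun N => isClosed_iInter fun h => ?_
  exact isClosed_eq (continuous_of_discreteTopology.comp (continuous_apply M)) (continuous_apply N)

/-- Every map of the basis to a finite `p`-group that is trivial at almost all elements extends
to a homomorphism on the free pro-`p`-group with open kernel. -/
theorem FreeProP.exists_lift [Fact p.Prime] {P : Type*} [Group P] {n : ℕ} (hP : Nat.card P = p ^ n)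
    (v : X → P) (hv : {x | v x ≠ 1}.Finite) :
    ∃ ψ : FreeProP p X →* P, (∀ x, ψ (FreeProP.of x) = v x) ∧
      IsOpen (ψ.ker : Set (FreeProP p X)) := by
  set φ : FreeGroup X →* P := FreeGroup.lift v with hφ
  have hidx : ∃ m, φ.ker.index = p ^ m := by
    rw [Subgroup.index_ker]
    have h := Subgroup.card_subgroup_dvd_card φ.range
    rw [hP] at h
    obtain ⟨m, -, hm⟩ := (Nat.dvd_prime_pow Fact.out).1 h
    exact ⟨m, hm⟩
  let N : FreeProPIndex p X := ⟨φ.ker, inferInstance, hidx, by simpa [hφ, MonoidHom.mem_ker] using hv⟩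
  let κ : FreeProPLevel N →* P := QuotientGroup.kerLift φ
  refine ⟨(κ.comp (Pi.evalMonoidHom _ N)).comp (FreeProP p X).subtype, fun x => ?_, ?_⟩
  · change κ (FreeProPLevel.mk N (FreeGroup.of x)) = v x
    exact (QuotientGroup.kerLift_mk φ _).trans (FreeGroup.lift_apply_of)
  · exact (isOpen_discrete (κ.ker : Set (FreeProPLevel N))).preimage
      ((continuous_apply N).comp continuous_subtype_val)

/-- An open kernel is closed, so once it contains `r` it contains the closed normal subgroup
generated by `r`. By compactness `π` is a quotient map, so openness of the new kernel can be tested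
on the free pro-`p`-group. -/
theorem IsOneRelatorProP.exists_lift [Fact p.Prime] {Γ : Type*} [Group Γ] [TopologicalSpace Γ]
    [IsTopologicalGroup Γ] [T2Space Γ] {s : X → Γ} {r : FreeProP p X}
    (h : IsOneRelatorProP p s r) {P : Type*} [Group P] {n : ℕ} (hP : Nat.card P = p ^ n)
    (v : X → P) (hv : {x | v x ≠ 1}.Finite)
    (hr : ∀ ψ : FreeProP p X →* P, (∀ x, ψ (FreeProP.of x) = v x) → ψ r = 1) :
    ∃ Φ : Γ →* P, (∀ x, Φ (s x) = v x) ∧ IsOpen (Φ.ker : Set Γ) := by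
  obtain ⟨π, hπc, hπs, hπ, hker⟩ := h
  obtain ⟨ψ, hψ, hψo⟩ := FreeProP.exists_lift hP v hv
  have hle : π.ker ≤ ψ.ker := by
    rw [hker]
    refine Subgroup.topologicalClosure_minimal _ (Subgroup.normalClosure_le_normal ?_)
      (Subgroup.isClosed_of_isOpen _ hψo)
    simpa [MonoidHom.mem_ker] using hr ψ hψ
  have hlift : ∀ g, π.liftOfSurjective hπs ⟨ψ, hle⟩ (π g) = ψ g := fun g =>
    MonoidHom.liftOfRightInverse_comp_apply _ _ _ ⟨ψ, hle⟩ g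
  refine ⟨π.liftOfSurjective hπs ⟨ψ, hle⟩, fun x => by rw [← hπ, hlift, hψ], ?_⟩
  have : CompactSpace (FreeProP p X) := FreeProP.compactSpace
  have hq : Topology.IsQuotientMap π := hπc.isClosedMap.isQuotientMap hπc hπs
  rw [← hq.isOpen_preimage]
  convert hψo using 1
  ext g
  simp only [Set.mem_preimage, SetLike.mem_coe, MonoidHom.mem_ker, hlift]

end UniversalProperty

/-! ### The Heisenberg group as a quotient of `Γ`. -/

section Heisenberg

/-- The Heisenberg group over a ring. -/
@[ext]
structure Heisenberg (R : Type*) where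
  /-- The entry in position `(1, 2)`. -/
  fst : R
  /-- The entry in position `(2, 3)`. -/
  snd : R
  /-- The entry in position `(1, 3)`. -/
  corner : R

namespace Heisenberg

variable {R : Type*} [CommRing R]

instance : Mul (Heisenberg R) :=
  ⟨fun g h => ⟨g.fst + h.fst, g.snd + h.snd, g.corner + h.corner + g.fst * h.snd⟩⟩

instance : One (Heisenberg R) := ⟨⟨0, 0, 0⟩⟩

instance : Inv (Heisenberg R) := ⟨fun g => ⟨-g.fst, -g.snd, -g.corner + g.fst * g.snd⟩⟩

@[simp] theorem fst_mul (g h : Heisenberg R) : (g * h).fst = g.fst + h.fst := rfl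
@[simp] theorem snd_mul (g h : Heisenberg R) : (g * h).snd = g.snd + h.snd := rfl
@[simp] theorem corner_mul (g h : Heisenberg R) :
    (g * h).corner = g.corner + h.corner + g.fst * h.snd := rfl
@[simp] theorem fst_one : (1 : Heisenberg R).fst = 0 := rfl
@[simp] theorem snd_one : (1 : Heisenberg R).snd = 0 := rfl
@[simp] theorem corner_one : (1 : Heisenberg R).corner = 0 := rfl
@[simp] theorem fst_inv (g : Heisenberg R) : g⁻¹.fst = -g.fst := rfl
@[simp] theorem snd_inv (g : Heisenberg R) : g⁻¹.snd = -g.snd := rfl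
@[simp] theorem corner_inv (g : Heisenberg R) : g⁻¹.corner = -g.corner + g.fst * g.snd := rfl

instance : Group (Heisenberg R) :=
  Group.ofLeftAxioms (fun a b c => by ext <;> simp <;> ring) (fun a => by ext <;> simp)
    (fun a => by ext <;> simp)

theorem pow_mk_zero (a : R) (n : ℕ) : (⟨a, 0, 0⟩ : Heisenberg R) ^ n = ⟨n * a, 0, 0⟩ := by
  induction n with
  | zero => ext <;> simp
  | succ n ih =>
    rw [pow_succ, ih]
    ext <;> simp
    ring

theorem card_zmod (p : ℕ) : Nat.card (Heisenberg (ZMod p)) = p ^ 3 := by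
  let e : Heisenberg (ZMod p) ≃ ZMod p × ZMod p × ZMod p :=
    { toFun := fun g => (g.fst, g.snd, g.corner)
      invFun := fun g => ⟨g.1, g.2.1, g.2.2⟩ }
  rw [Nat.card_congr e, Nat.card_prod, Nat.card_prod, Nat.card_zmod]
  ring

/-- The projection to the first coordinate. -/
def fstHom (R : Type*) [CommRing R] : Heisenberg R →* Multiplicative R where
  toFun g := .ofAdd g.fst
  map_one' := rfl
  map_mul' _ _ := rfl

/-- The images of the generators in the Heisenberg group. -/
def generators (R I : Type*) [CommRing R] : Fin 2 ⊕ I → Heisenberg R :=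
  Sum.elim ![⟨1, 0, 0⟩, ⟨0, 1, 0⟩] 1

theorem iteratedCommutator_eq_one {f : ℕ} (hf : 2 ≤ f) :
    iteratedCommutator (⟨1, 0, 0⟩ : Heisenberg R) ⟨0, 1, 0⟩ f = 1 := by
  induction f, hf using Nat.le_induction with
  | base =>
    simp only [iteratedCommutator, commutatorElement_def]
    ext <;> simp
  | succ n _ ih =>
    rw [iteratedCommutator, ih, commutatorElement_one_right]

theorem demushkinLikeWord_generators (p : ℕ) {I : Type*} {f q : ℕ} (hf : 2 ≤ f)
    (hq : p ^ 2 ∣ q) (J : List (I × I)) (K : List I) :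
    demushkinLikeWord (generators (ZMod p) I) p q f J K = 1 := by
  have h1 : (⟨1, 0, 0⟩ : Heisenberg (ZMod p)) ^ q = 1 := by
    obtain ⟨k, rfl⟩ := hq
    rw [pow_mk_zero]
    ext <;> simp
  simp [demushkinLikeWord, generators, h1, iteratedCommutator_eq_one hf]

end Heisenberg

end Heisenberg

/-! ### The corner character meets the obstruction. -/

section Kernel

variable {p : ℕ} {Γ I : Type*} [Group Γ]

theorem false_of_lift [Fact p.Prime] {s : Fin 2 ⊕ I → Γ} {f q : ℕ}
    (hfp : f < p) (hq : p ^ 2 ∣ q) {J : List (I × I)} {K : List I}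
    (hrel : demushkinLikeWord s p q f J K = 1) {Φ : Γ →* Heisenberg (ZMod p)}
    (hΦ : ∀ x, Φ (s x) = Heisenberg.generators (ZMod p) I x)
    {θ : Γ →* ZMod (p ^ 2)} (hθ : ∀ g, redModSq p (θ g) = 1)
    {c : ((Heisenberg.fstHom (ZMod p)).comp Φ).ker → ZMod (p ^ 2)}
    (hc : IsTwistedHom (θ.comp (Subgroup.subtype _)) c)
    (hcΦ : ∀ h, redModSq p (c h) = (Φ h).corner) : False := by
  have e0 : Φ (s (.inl 0)) = ⟨1, 0, 0⟩ := hΦ _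
  have e1 : Φ (s (.inl 1)) = ⟨0, 1, 0⟩ := hΦ _
  have eI : ∀ i, Φ (s (.inr i)) = 1 := fun i => hΦ _
  refine not_isTwistedHom_of_relation hfp hq hrel
    ((Heisenberg.fstHom (ZMod p)).comp Φ).ker ?_ ?_ ?_ hθ hc ?_ ?_ ?_
  · rw [MonoidHom.mem_ker, MonoidHom.comp_apply, map_pow, e0, Heisenberg.pow_mk_zero]
    simp [Heisenberg.fstHom]
  · rw [MonoidHom.mem_ker, MonoidHom.comp_apply, e1]
    rfl
  · intro i
    rw [MonoidHom.mem_ker, MonoidHom.comp_apply, eI, map_one]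
  · rw [hcΦ, map_pow, e0, Heisenberg.pow_mk_zero]
  · intro b
    rw [hcΦ]
    simp only [map_mul, map_inv, map_pow, e0, e1, Heisenberg.pow_mk_zero]
    simp
  · intro i b
    rw [hcΦ]
    simp only [map_mul, map_inv, map_pow, e0, eI, Heisenberg.pow_mk_zero]
    simp

end Kernel

/-! ### Hilbert 90 through embeddings of a finite subextension. -/

section HilbertNinety

variable {F Ω : Type*} [Field F] [Field Ω] [Algebra F Ω] {H : Type*} [Group H]
  (ρ : H →* Gal(Ω/F)) (E : IntermediateField F Ω)

/-- The embedding of `E` given by the action of `h`. -/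
def embeddingOf (h : H) : E →ₐ[F] Ω := (ρ h : Ω →ₐ[F] Ω).comp E.val

/-- Composition of embeddings of `E` with the action of `g`. -/
def embeddingPerm (g : H) : (E →ₐ[F] Ω) ≃ (E →ₐ[F] Ω) := AlgEquiv.refl.arrowCongr (ρ g)

@[simp] theorem embeddingPerm_apply (g : H) (e : E →ₐ[F] Ω) (x : E) :
    embeddingPerm ρ E g e x = ρ g (e x) := rfl

theorem embeddingPerm_embeddingOf (g h : H) :
    embeddingPerm ρ E g (embeddingOf ρ E h) = embeddingOf ρ E (g * h) := by
  ext x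
  simp [embeddingPerm, embeddingOf]

theorem embeddingPerm_mem_range_iff (g : H) (e : E →ₐ[F] Ω) :
    (∃ h, embeddingOf ρ E h = embeddingPerm ρ E g e) ↔ ∃ h, embeddingOf ρ E h = e := by
  constructor
  · rintro ⟨h, hh⟩
    refine ⟨g⁻¹ * h, (embeddingPerm ρ E g).injective ?_⟩
    rw [embeddingPerm_embeddingOf, mul_inv_cancel_left, hh]
  · rintro ⟨h, rfl⟩
    exact ⟨g * h, (embeddingPerm_embeddingOf ρ E g h).symm⟩

variable {ρ E}

theorem fixes_of_embeddingOf_eq {g h : H} (e : embeddingOf ρ E g = embeddingOf ρ E h) :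
    ∀ x ∈ E, ρ (g⁻¹ * h) x = x := by
  intro x hx
  have h1 : ρ g x = ρ h x := DFunLike.congr_fun e ⟨x, hx⟩
  rw [map_mul, AlgEquiv.mul_apply, ← h1, ← AlgEquiv.mul_apply, ← map_mul, inv_mul_cancel, map_one,
    AlgEquiv.one_apply]

/-- Dedekind's independence of embeddings. -/
theorem exists_sum_mul_ne_zero [FiniteDimensional F E] {k : (E →ₐ[F] Ω) → Ω} (hk : k ≠ 0) :
    ∃ x : E, ∑ e, k e * e x ≠ 0 := by
  by_contra! h
  refine hk (funext (Fintype.linearIndependent_iff.1 (linearIndependent_toLinearMap F E Ω) k ?_))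
  ext x
  simpa using h x

/-- A multiplicative form of Hilbert's theorem 90. -/
theorem exists_apply_eq_mul [FiniteDimensional F E] {u : H → Ω}
    (hu : ∀ g h, u (g * h) = u g * u h) (hρ : ∀ g h, ρ g (u h) = u h) (hu0 : ∀ g, u g ≠ 0)
    (hE : ∀ h, (∀ x ∈ E, ρ h x = x) → u h = 1) : ∃ a : Ω, a ≠ 0 ∧ ∀ g, ρ g a = u g * a := by
  classical
  have hfac : Function.FactorsThrough (fun h => (u h)⁻¹) (embeddingOf ρ E) := by
    intro g h e
    have h1 := hE _ (fixes_of_embeddingOf_eq e)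
    have h2 := hu g (g⁻¹ * h)
    rw [mul_inv_cancel_left, h1, mul_one] at h2
    simp [h2]
  -- Coefficients of a Lagrange resolvent. Indexing by embeddings of `E`, with `0` off the orbit of
  -- `H`, avoids assuming that `E` is normal.
  set k := Function.extend (embeddingOf ρ E) (fun h => (u h)⁻¹) 0 with hk
  have hkof : ∀ h, k (embeddingOf ρ E h) = (u h)⁻¹ := fun h => hfac.extend_apply _ h
  have hk' : ∀ e, (¬ ∃ h, embeddingOf ρ E h = e) → k e = 0 := fun e he =>
    Function.extend_apply' _ _ _ he
  have hk0 : k ≠ 0 := fun h => inv_ne_zero (hu0 1) (by rw [← hkof, h, Pi.zero_apply])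
  obtain ⟨x, hx⟩ := exists_sum_mul_ne_zero hk0
  refine ⟨_, hx, fun g => ?_⟩
  rw [map_sum, ← Equiv.sum_comp (embeddingPerm ρ E g) (fun e => k e * e x), Finset.mul_sum]
  refine Finset.sum_congr rfl fun e _ => ?_
  rw [map_mul, embeddingPerm_apply, ← mul_assoc]
  congr 1
  by_cases he : ∃ h, embeddingOf ρ E h = e
  · obtain ⟨h, rfl⟩ := he
    rw [embeddingPerm_embeddingOf, hkof, hkof, map_inv₀, hρ, hu, mul_inv,
      mul_inv_cancel_left₀ (hu0 g)]
  · rw [hk' e he, hk' _ (mt (embeddingPerm_mem_range_iff ρ E g e).1 he), map_zero, mul_zero]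

/-- An additive form of Hilbert's theorem 90. -/
theorem exists_apply_eq_add [FiniteDimensional F E] {u : H → Ω}
    (hu : ∀ g h, u (g * h) = u g + u h) (hρ : ∀ g h, ρ g (u h) = u h)
    (hE : ∀ h, (∀ x ∈ E, ρ h x = x) → u h = 0) : ∃ a : Ω, ∀ g, ρ g a = a + u g := by
  classical
  have hfac : Function.FactorsThrough u (embeddingOf ρ E) := by
    intro g h e
    have h1 := hE _ (fixes_of_embeddingOf_eq e)
    have h2 := hu g (g⁻¹ * h)
    rw [mul_inv_cancel_left, h1, add_zero] at h2
    exact h2.symm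
  -- `k` gives an invariant, trace-like sum `t ≠ 0`; weighting by `u` gives `S` with `ρ g S = S - u
  -- g * t`, whence the solution `-S / t`.
  set k : (E →ₐ[F] Ω) → Ω := fun e => if ∃ h, embeddingOf ρ E h = e then 1 else 0 with hk
  set l := Function.extend (embeddingOf ρ E) u 0 with hl
  have hkof : ∀ h, k (embeddingOf ρ E h) = 1 := fun h => if_pos ⟨h, rfl⟩
  have hlof : ∀ h, l (embeddingOf ρ E h) = u h := fun h => hfac.extend_apply _ h
  have hk' : ∀ e, (¬ ∃ h, embeddingOf ρ E h = e) → k e = 0 := fun e he => if_neg he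
  have hl' : ∀ e, (¬ ∃ h, embeddingOf ρ E h = e) → l e = 0 := fun e he =>
    Function.extend_apply' _ _ _ he
  have hk0 : k ≠ 0 := fun h => one_ne_zero (α := Ω) (by rw [← hkof 1, h, Pi.zero_apply])
  obtain ⟨x, hx⟩ := exists_sum_mul_ne_zero hk0
  set t := ∑ e, k e * e x with ht
  set S := ∑ e, l e * e x with hS
  have hkt : ∀ g, ρ g t = t := by
    intro g
    rw [ht, map_sum, ← Equiv.sum_comp (embeddingPerm ρ E g) (fun e => k e * e x)]
    refine Finset.sum_congr rfl fun e _ => ?_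
    rw [map_mul, embeddingPerm_apply]
    congr 1
    by_cases he : ∃ h, embeddingOf ρ E h = e
    · obtain ⟨h, rfl⟩ := he
      rw [embeddingPerm_embeddingOf, hkof, hkof, map_one]
    · rw [hk' e he, hk' _ (mt (embeddingPerm_mem_range_iff ρ E g e).1 he), map_zero]
  have hlS : ∀ g, ρ g S = S - u g * t := by
    intro g
    rw [hS, ht, map_sum, ← Equiv.sum_comp (embeddingPerm ρ E g) (fun e => l e * e x),
      ← Equiv.sum_comp (embeddingPerm ρ E g) (fun e => k e * e x), Finset.mul_sum,
      ← Finset.sum_sub_distrib]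
    refine Finset.sum_congr rfl fun e _ => ?_
    rw [map_mul, embeddingPerm_apply]
    by_cases he : ∃ h, embeddingOf ρ E h = e
    · obtain ⟨h, rfl⟩ := he
      rw [embeddingPerm_embeddingOf, hkof, hlof, hlof, hρ, hu]
      ring
    · have he' := mt (embeddingPerm_mem_range_iff ρ E g e).1 he
      rw [hl' e he, hl' _ he', hk' _ he', map_zero]
      ring
  refine ⟨-S / t, fun g => ?_⟩
  rw [map_div₀, map_neg, hkt, hlS]
  field_simp
  ring

end HilbertNinety

/-! ### Lifting characters by Kummer theory. -/

section KummerLift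

variable {p : ℕ} [Fact p.Prime] {F Ω : Type*} [Field F] [Field Ω] [Algebra F Ω]
  {G : Type*} [Group G]

theorem natCast_eq_of_pow_eq {ζ : Ω} {n : ℕ} [NeZero n] (hζ : IsPrimitiveRoot ζ n) {i j : ℕ}
    (h : ζ ^ i = ζ ^ j) : (i : ZMod n) = j := by
  rw [ZMod.natCast_eq_natCast_iff]
  have hu := hζ.isUnit (NeZero.ne n)
  have h2 : hu.unit ^ i = hu.unit ^ j := Units.ext (by simpa using h)
  have h3 := pow_eq_pow_iff_modEq.1 h2
  rwa [← (hζ.isUnit_unit (NeZero.ne n)).eq_orderOf] at h3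

/-- In characteristic different from `p`, characters of order `p` lift to twisted homomorphisms
modulo `p²`, by Kummer theory. -/
theorem exists_lift_of_natCast_ne_zero [IsAlgClosed Ω] (hpΩ : (p : Ω) ≠ 0) (ρ : G →* Gal(Ω/F))
    (hμ : ∀ g ω, ω ^ p = 1 → ρ g ω = ω) (H : Subgroup G) (χ : H → ZMod p)
    (hχ : ∀ g h, χ (g * h) = χ g + χ h) (E : IntermediateField F Ω) [FiniteDimensional F E]
    (hE : ∀ h : H, (∀ x ∈ E, ρ h x = x) → χ h = 0) :
    ∃ (θ : G →* ZMod (p ^ 2)) (c : H → ZMod (p ^ 2)), (∀ g, redModSq p (θ g) = 1) ∧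
      IsTwistedHom (θ.comp H.subtype) c ∧ ∀ h, redModSq p (c h) = χ h := by
  have hp : p.Prime := Fact.out
  have : NeZero (p ^ 2) := ⟨pow_ne_zero _ hp.ne_zero⟩
  have : NeZero ((p ^ 2 : ℕ) : Ω) := ⟨by push_cast; exact pow_ne_zero _ hpΩ⟩
  obtain ⟨ζ, hζ⟩ := HasEnoughRootsOfUnity.exists_primitiveRoot Ω (p ^ 2)
  set ω := ζ ^ p with hω_def
  have hω : IsPrimitiveRoot ω p := hζ.pow (NeZero.pos _) (sq p)
  have hζ0 : ζ ≠ 0 := hζ.ne_zero (NeZero.ne _)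
  have hred : ∀ (n : ℕ) (z : ZMod p), ω ^ n = ω ^ z.val → redModSq p (n : ZMod (p ^ 2)) = z := by
    intro n z h
    rw [map_natCast, natCast_eq_of_pow_eq hω h, ZMod.natCast_zmod_val]
  have hωval : ∀ z w : ZMod p, ω ^ (z + w).val = ω ^ z.val * ω ^ w.val := by
    intro z w
    rw [← pow_add, ZMod.val_add, ← pow_mod_orderOf ω (z.val + w.val), ← hω.eq_orderOf]
  have hωfix : ∀ (g : G) (n : ℕ), ρ g (ω ^ n) = ω ^ n := fun g n =>
    hμ _ _ (by rw [← pow_mul, mul_comm, pow_mul, hω.pow_eq_one, one_pow])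
  obtain ⟨a, ha0, ha⟩ := exists_apply_eq_mul (ρ := ρ.comp H.subtype) (E := E)
    (u := fun h => ω ^ (χ h).val) (fun g h => by rw [hχ, hωval]) (fun g h => hωfix g _)
    (fun h => pow_ne_zero _ (pow_ne_zero _ hζ0)) (fun h hh => by simp [hE h hh])
  obtain ⟨b, hb⟩ := IsAlgClosed.exists_pow_nat_eq a hp.pos
  have hb0 : b ≠ 0 := by
    rintro rfl
    exact ha0 (by rw [← hb, zero_pow hp.ne_zero])
  have hθ : ∀ g, ∃ n : ℕ, ρ g ζ = ζ ^ n := by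
    intro g
    obtain ⟨i, -, hi⟩ := hζ.eq_pow_of_pow_eq_one
      (show ρ g ζ ^ p ^ 2 = 1 by rw [← map_pow, hζ.pow_eq_one, map_one])
    exact ⟨i, hi.symm⟩
  choose m hm using hθ
  -- The exponent `n` is the Kummer cocycle of `a = bᵖ` at level `p²`; raising to the power `p`
  -- recovers `χ` mod `p`. The exponents `m` form the cyclotomic character.
  have hc : ∀ h : H, ∃ n : ℕ, ρ h b = ζ ^ n * b := by
    intro h
    obtain ⟨i, -, hi⟩ := hζ.eq_pow_of_pow_eq_one (ξ := ρ h b / b) (by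
      rw [sq, pow_mul, div_pow, ← map_pow, hb]
      have := ha h
      simp only [MonoidHom.comp_apply, Subgroup.subtype_apply] at this
      rw [this, mul_div_cancel_right₀ _ ha0, ← pow_mul, mul_comm, pow_mul, hω.pow_eq_one, one_pow])
    exact ⟨i, by rw [hi, div_mul_cancel₀ _ hb0]⟩
  choose n hn using hc
  refine ⟨⟨⟨fun g => m g, ?_⟩, ?_⟩, fun h => n h, ?_, ?_, ?_⟩
  · rw [← Nat.cast_one]
    apply natCast_eq_of_pow_eq hζ
    rw [← hm, map_one, AlgEquiv.one_apply, pow_one]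
  · intro g h
    dsimp only
    rw [← Nat.cast_mul]
    apply natCast_eq_of_pow_eq hζ
    rw [← hm, map_mul, AlgEquiv.mul_apply, hm, map_pow, hm, pow_mul]
  · intro g
    apply hred
    rw [ZMod.val_one, pow_one, hω_def, ← pow_mul, mul_comm, pow_mul, ← hm, ← map_pow, ← hω_def]
    simpa using hωfix g 1
  · intro g h
    change ((n (g * h) : ℕ) : ZMod (p ^ 2)) = n g + m g * n h
    rw [← Nat.cast_mul, ← Nat.cast_add]
    apply natCast_eq_of_pow_eq hζ
    apply mul_right_cancel₀ hb0
    rw [← hn, Subgroup.coe_mul, map_mul, AlgEquiv.mul_apply, hn, map_mul, map_pow, hm, hn, pow_add,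
      pow_mul]
    ring
  · intro h
    apply hred
    apply mul_right_cancel₀ ha0
    have := ha h
    simp only [MonoidHom.comp_apply, Subgroup.subtype_apply] at this
    rw [← this, ← hb, map_pow, hn, mul_pow, hω_def, ← pow_mul, ← pow_mul, mul_comm p]

end KummerLift

/-! ### Lifting characters by Witt vectors of length two. -/

section WittLift

variable {p : ℕ}

/-- The polynomial `((x + y)ᵖ - xᵖ - yᵖ) / p`. -/
def wittCocycle (p : ℕ) {R : Type*} [CommRing R] (x y : R) : R :=
  ∑ k ∈ Finset.Ioo 0 p, x ^ k * y ^ (p - k) * ((p.choose k / p : ℕ) : R)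

theorem map_wittCocycle {R S : Type*} [CommRing R] [CommRing S] (φ : R →+* S) (x y : R) :
    φ (wittCocycle p x y) = wittCocycle p (φ x) (φ y) := by
  simp [wittCocycle]

theorem add_pow_eq_add_wittCocycle (hp : p.Prime) {R : Type*} [CommRing R] (x y : R) :
    (x + y) ^ p = x ^ p + y ^ p + p * wittCocycle p x y :=
  add_pow_prime_eq' hp x y

/-- After multiplication by `p` both sides are `(x + y + z)ᵖ - xᵖ - yᵖ - zᵖ`. Cancelling `p` is
legitimate in `ℤ[X, Y, Z]`, and the identity then specializes to `R`. -/
theorem wittCocycle_add (hp : p.Prime) {R : Type*} [CommRing R] (x y z : R) :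
    wittCocycle p x y + wittCocycle p (x + y) z = wittCocycle p x (y + z) + wittCocycle p y z := by
  have key : wittCocycle p (MvPolynomial.X 0 : MvPolynomial (Fin 3) ℤ) (MvPolynomial.X 1) +
        wittCocycle p (MvPolynomial.X 0 + MvPolynomial.X 1) (MvPolynomial.X 2) =
      wittCocycle p (MvPolynomial.X 0) (MvPolynomial.X 1 + MvPolynomial.X 2) +
        wittCocycle p (MvPolynomial.X 1) (MvPolynomial.X 2) := by
    have h0 : (p : MvPolynomial (Fin 3) ℤ) ≠ 0 := Nat.cast_ne_zero.2 hp.ne_zero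
    apply mul_left_cancel₀ h0
    generalize (MvPolynomial.X 0 : MvPolynomial (Fin 3) ℤ) = X
    generalize (MvPolynomial.X 1 : MvPolynomial (Fin 3) ℤ) = Y
    generalize (MvPolynomial.X 2 : MvPolynomial (Fin 3) ℤ) = Z
    have h1 := add_pow_eq_add_wittCocycle hp X Y
    have h2 := add_pow_eq_add_wittCocycle hp (X + Y) Z
    have h3 := add_pow_eq_add_wittCocycle hp X (Y + Z)
    have h4 := add_pow_eq_add_wittCocycle hp Y Z
    rw [← add_assoc] at h3
    linear_combination h3 + h4 - h1 - h2
  have h := congrArg (MvPolynomial.eval₂Hom (Int.castRingHom R) ![x, y, z]) key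
  simp only [map_add, map_wittCocycle, MvPolynomial.eval₂Hom_X'] at h
  exact h

theorem wittCocycle_comm (hp : p.Prime) {R : Type*} [CommRing R] (x y : R) :
    wittCocycle p x y = wittCocycle p y x := by
  have key : wittCocycle p (MvPolynomial.X 0 : MvPolynomial (Fin 2) ℤ) (MvPolynomial.X 1) =
      wittCocycle p (MvPolynomial.X 1) (MvPolynomial.X 0) := by
    have h0 : (p : MvPolynomial (Fin 2) ℤ) ≠ 0 := Nat.cast_ne_zero.2 hp.ne_zero
    apply mul_left_cancel₀ h0
    generalize (MvPolynomial.X 0 : MvPolynomial (Fin 2) ℤ) = X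
    generalize (MvPolynomial.X 1 : MvPolynomial (Fin 2) ℤ) = Y
    have h1 := add_pow_eq_add_wittCocycle hp X Y
    have h2 := add_pow_eq_add_wittCocycle hp Y X
    rw [add_comm Y X] at h2
    linear_combination h2 - h1
  have h := congrArg (MvPolynomial.eval₂Hom (Int.castRingHom R) ![x, y]) key
  simp only [map_wittCocycle, MvPolynomial.eval₂Hom_X'] at h
  exact h

variable [Fact p.Prime]

theorem pow_eq_pow_of_redModSq_eq {a b : ZMod (p ^ 2)} (h : redModSq p a = redModSq p b) :
    a ^ p = b ^ p := by
  obtain ⟨u, hu⟩ := exists_eq_mul_of_redModSq_eq_zero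
    (show redModSq p (a - b) = 0 by rw [map_sub, h, sub_self])
  have hp : p.Prime := Fact.out
  have hz : ((p : ZMod (p ^ 2)) * u) ^ p = 0 := by
    refine pow_eq_zero_of_le hp.two_le ?_
    rw [mul_pow, sq (p : ZMod (p ^ 2)), natCast_mul_self_modSq, zero_mul]
  have hw : redModSq p (wittCocycle p (p * u) b) = 0 := by
    rw [map_wittCocycle, map_mul, map_natCast, CharP.cast_eq_zero, zero_mul, wittCocycle]
    refine Finset.sum_eq_zero fun k hk => ?_
    rw [zero_pow (Finset.mem_Ioo.1 hk).1.ne', zero_mul, zero_mul]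
  rw [show a = p * u + b by linear_combination hu, add_pow_eq_add_wittCocycle hp, hz, zero_add,
    mul_eq_zero_of_redModSq (by simp) hw, add_zero]

variable {F Ω : Type*} [Field F] [Field Ω] [Algebra F Ω] [IsAlgClosed Ω] {G : Type*} [Group G]

/-- In characteristic `p`, characters of order `p` lift to characters of order `p²`, by the
theory of Witt vectors of length two. -/
theorem exists_lift_of_charP [CharP Ω p] (ρ : G →* Gal(Ω/F)) (H : Subgroup G) (χ : H → ZMod p)
    (hχ : ∀ g h, χ (g * h) = χ g + χ h) (E : IntermediateField F Ω) [FiniteDimensional F E]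
    (hE : ∀ h : H, (∀ x ∈ E, ρ h x = x) → χ h = 0) :
    ∃ (θ : G →* ZMod (p ^ 2)) (c : H → ZMod (p ^ 2)), (∀ g, redModSq p (θ g) = 1) ∧
      IsTwistedHom (θ.comp H.subtype) c ∧ ∀ h, redModSq p (c h) = χ h := by
  have hp : p.Prime := Fact.out
  let ι : ZMod p →+* Ω := ZMod.castHom dvd_rfl Ω
  have hι : Function.Injective ι := ι.injective
  have hιfix : ∀ (g : G) z, ρ g (ι z) = ι z := fun g z => by
    have : ((ρ g : Ω →ₐ[F] Ω) : Ω →+* Ω).comp ι = ι := Subsingleton.elim _ _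
    exact DFunLike.congr_fun this z
  have hιpow : ∀ z, ι z ^ p = ι z := fun z => by rw [← map_pow, ZMod.pow_card]
  have hιsurj : ∀ y : Ω, y ^ p = y → ∃ z, ι z = y := fun y hy => by
    have h := (Subfield.mem_bot_iff_pow_eq_self Ω p).2 hy
    rwa [← ZMod.fieldRange_castHom_eq_bot p] at h
  obtain ⟨a, ha⟩ := exists_apply_eq_add (ρ := ρ.comp H.subtype) (E := E)
    (u := fun h => ι (χ h)) (fun g h => by rw [hχ, map_add]) (fun g h => hιfix g _)
    (fun h hh => by rw [hE h hh, map_zero])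
  replace ha : ∀ h : H, ρ h a = a + ι (χ h) := ha
  have hfrob : ∀ x y : Ω, (x + y) ^ p = x ^ p + y ^ p := fun x y => add_pow_char x y p
  have hfrobS : ∀ x y : Ω, (x - y) ^ p = x ^ p - y ^ p := fun x y => sub_pow_char x y
  set e := a ^ p - a with he
  have he_fix : ∀ h : H, ρ h e = e := fun h => by
    rw [he, map_sub, map_pow, ha, hfrob, hιpow]
    ring
  -- This says that the Witt vector `(a, b)` satisfies `Frob (a, b) = (a, b) + (e, 0)`, with `e`
  -- fixed by `H`.
  obtain ⟨b, hb⟩ : ∃ b : Ω, b ^ p - b = -wittCocycle p a e := by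
    have hdeg : (Polynomial.X ^ p - Polynomial.X + Polynomial.C (wittCocycle p a e)).degree ≠ 0 := by
      apply Polynomial.degree_ne_of_natDegree_ne
      rw [Polynomial.natDegree_add_C, FiniteField.X_pow_card_sub_X_natDegree_eq Ω hp.one_lt]
      exact hp.ne_zero
    obtain ⟨b, hb⟩ := IsAlgClosed.exists_root _ hdeg
    refine ⟨b, ?_⟩
    simp only [Polynomial.IsRoot.def, Polynomial.eval_add, Polynomial.eval_sub, Polynomial.eval_pow,
      Polynomial.eval_X, Polynomial.eval_C] at hb
    linear_combination hb
  have hW : ∀ x y : Ω, wittCocycle p x y ^ p = wittCocycle p (x ^ p) (y ^ p) := fun x y =>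
    map_wittCocycle (frobenius Ω p) x y
  have hWρ : ∀ (g : G) (x y : Ω), ρ g (wittCocycle p x y) = wittCocycle p (ρ g x) (ρ g y) :=
    fun g x y => map_wittCocycle ((ρ g : Ω →ₐ[F] Ω) : Ω →+* Ω) x y
  -- The second component of the Witt vector `h (a, b) - (a, b)`; it is Frobenius-invariant, hence
  -- in the prime field.
  have hm : ∀ h : H, ∃ z, ι z = ρ h b - b + wittCocycle p a (ι (χ h)) := by
    intro h
    apply hιsurj
    have h1 : ρ h b ^ p - ρ h b = -wittCocycle p (a + ι (χ h)) e := by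
      rw [← map_pow, ← map_sub, hb, map_neg, hWρ, ha, he_fix]
    have h2 := wittCocycle_add hp a e (ι (χ h))
    have h3 := wittCocycle_add hp a (ι (χ h)) e
    rw [add_comm (ι (χ h)) e, wittCocycle_comm hp (ι (χ h)) e] at h3
    rw [hfrob, hfrobS, hW, hιpow, show a ^ p = a + e by rw [he]; ring]
    linear_combination h1 - hb + h2 - h3
  choose m hm using hm
  have hmadd : ∀ g h : H, m (g * h) + wittCocycle p (χ g) (χ h) = m g + m h := by
    intro g h
    apply hι
    rw [map_add, map_add, hm, hm, hm, map_wittCocycle, hχ, map_add]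
    have h1 := congrArg (ρ g) (hm h)
    rw [hιfix, hm, map_add, map_sub, hWρ, ha, hιfix] at h1
    have h3 := wittCocycle_add hp a (ι (χ g)) (ι (χ h))
    rw [Subgroup.coe_mul, map_mul, AlgEquiv.mul_apply]
    linear_combination -h1 - h3
  have hlift : ∀ z : ZMod p, redModSq p (z.val : ZMod (p ^ 2)) = z := fun z => by
    rw [map_natCast, ZMod.natCast_zmod_val]
  -- The ghost coordinate `xᵖ + p y` on lifts to `ℤ/p²` identifies the Witt vectors of length two
  -- over `ℤ/p` with `ℤ/p²`.
  refine ⟨1, fun h => ((χ h).val : ZMod (p ^ 2)) ^ p + p * ((m h).val : ZMod (p ^ 2)), by simp,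
    ?_, ?_⟩
  · intro g h
    have h1 : ((χ (g * h)).val : ZMod (p ^ 2)) ^ p =
        (((χ g).val : ZMod (p ^ 2)) + (χ h).val) ^ p := by
      apply pow_eq_pow_of_redModSq_eq
      rw [map_add, hlift, hlift, hlift, hχ]
    rw [add_pow_eq_add_wittCocycle hp] at h1
    have h2 : (p : ZMod (p ^ 2)) * (((m (g * h)).val : ZMod (p ^ 2)) +
        wittCocycle p ((χ g).val : ZMod (p ^ 2)) ((χ h).val : ZMod (p ^ 2)) - (m g).val -
          (m h).val) = 0 := by
      apply mul_eq_zero_of_redModSq (by simp)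
      rw [map_sub, map_sub, map_add, map_wittCocycle]
      simp only [hlift]
      linear_combination hmadd g h
    simp only [MonoidHom.comp_apply, MonoidHom.one_apply]
    linear_combination h1 + h2
  · intro h
    rw [map_add, map_pow, hlift, ZMod.pow_card, map_mul, map_natCast, CharP.cast_eq_zero, zero_mul,
      add_zero]

end WittLift

/-! ### Triviality on `p`-th roots of unity, and the conclusion. -/

theorem fixes_rootsOfUnity {p : ℕ} [Fact p.Prime] {Γ : Type*} [Group Γ] [TopologicalSpace Γ]
    [IsTopologicalGroup Γ] (hΓ : IsProP p Γ) {F Ω : Type*} [Field F] [Field Ω] [Algebra F Ω]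
    [Algebra.IsIntegral F Ω] [IsAlgClosed Ω] (hpΩ : (p : Ω) ≠ 0) {ρ : Γ →* Gal(Ω/F)}
    (hρ : Continuous ρ) (g : Γ) {ω : Ω} (hω : ω ^ p = 1) : ρ g ω = ω := by
  have : NeZero (p : Ω) := ⟨hpΩ⟩
  obtain ⟨ζ, hζ⟩ := HasEnoughRootsOfUnity.exists_primitiveRoot Ω p
  have hpow : ∀ ξ : Ω, ξ ^ p = 1 → ∃ i : ℕ, ζ ^ i = ξ := fun ξ hξ =>
    let ⟨i, _, hi⟩ := hζ.eq_pow_of_pow_eq_one hξ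
    ⟨i, hi⟩
  let U : Subgroup Γ :=
    { carrier := {g | ∀ ξ : Ω, ξ ^ p = 1 → ρ g ξ = ξ}
      mul_mem' := fun {a b} ha hb ξ hξ => by
        rw [map_mul, AlgEquiv.mul_apply, hb ξ hξ, ha ξ hξ]
      one_mem' := fun ξ _ => by rw [map_one, AlgEquiv.one_apply]
      inv_mem' := fun {a} ha ξ hξ => (ρ a).injective (by
        rw [← AlgEquiv.mul_apply, ← map_mul, mul_inv_cancel, map_one, AlgEquiv.one_apply,
          ha ξ hξ]) }
  have hUn : U.Normal := ⟨fun a ha b ξ hξ => by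
    rw [map_mul, map_mul, AlgEquiv.mul_apply, AlgEquiv.mul_apply,
      ha _ (by rw [← map_pow, hξ, map_one]), ← AlgEquiv.mul_apply, ← map_mul, mul_inv_cancel,
      map_one, AlgEquiv.one_apply]⟩
  have hUo : IsOpen (U : Set Γ) := by
    have h := (stabilizer_isOpen_of_isIntegral (K := F) ζ).preimage hρ
    refine Subgroup.isOpen_mono (H₁ := (MulAction.stabilizer Gal(Ω/F) ζ).comap ρ) ?_ h
    intro a ha ξ hξ
    obtain ⟨i, rfl⟩ := hpow ξ hξ
    have ha' : ρ a ζ = ζ := ha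
    rw [map_pow, ha']
  obtain ⟨k, hk⟩ := hΓ.isPGroup_quotient U hUo (g : Γ ⧸ U)
  have hk' : g ^ p ^ k ∈ U := (QuotientGroup.eq_one_iff _).1 hk
  obtain ⟨m, hm⟩ := hpow (ρ g ζ) (by rw [← map_pow, hζ.pow_eq_one, map_one])
  have hiter : ∀ n : ℕ, ρ (g ^ n) ζ = ζ ^ m ^ n := by
    intro n
    induction n with
    | zero => simp
    | succ n ih => rw [pow_succ', map_mul, AlgEquiv.mul_apply, ih, map_pow, ← hm, ← pow_mul, pow_succ']
  have h1 : ζ ^ m ^ p ^ k = ζ ^ 1 := by rw [← hiter, hk' ζ hζ.pow_eq_one, pow_one]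
  -- If `g` raises `ζ` to the power `m`, then `m ^ pᵏ = 1` in `ℤ/p`; by Fermat the left side is `m`,
  -- so `m = 1`.
  have h2 := natCast_eq_of_pow_eq hζ h1
  rw [Nat.cast_pow, ZMod.pow_card_pow] at h2
  have h3 : ζ ^ m = ζ := by
    conv_rhs => rw [← pow_one ζ]
    rw [← pow_mod_orderOf ζ m, ← pow_mod_orderOf ζ 1, ← hζ.eq_orderOf]
    rw [(ZMod.natCast_eq_natCast_iff' m 1 p).1 h2]
  obtain ⟨i, rfl⟩ := hpow ω hω
  rw [map_pow, ← hm, h3]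

theorem mainTheorem2 (p : ℕ) (hp : p.Prime) (hodd : Odd p)
    (Γ : Type*) [Group Γ] [TopologicalSpace Γ] [IsTopologicalGroup Γ] (hΓ : IsProP p Γ)
    (I : Type*) (σ : Fin 2 ⊕ I → Γ) (hσ : MinimallyGenerates σ)
    (f q : ℕ) (hf₂ : 2 ≤ f) (hfp : f ≤ p - 1) (hq : p ^ 2 ∣ q)
    (J : List (I × I)) (hJ : J.Nodup) (K : List I) (hK : K.Nodup)
    (hrel : IsOneRelatorProP p σ (demushkinLikeWord (FreeProP.of (p := p)) p q f J K))
    (F : Type*) [Field F] :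
    IsEmpty (Γ ≃ₜ* Field.absoluteGaloisGroup F) := by
  refine ⟨fun e => ?_⟩
  have : Fact p.Prime := ⟨hp⟩
  have := hΓ.t2Space
  have hfp' : f < p := by have := hp.pos; lia
  let ρ : Γ →* Gal(AlgebraicClosure F/F) := e.toMulEquiv.toMonoidHom
  have hρ : Continuous ρ := e.continuous_toFun
  have hword : demushkinLikeWord σ p q f J K = 1 := by
    obtain ⟨π, -, -, hπ, hker⟩ := hrel
    have h : demushkinLikeWord (FreeProP.of (p := p)) p q f J K ∈ π.ker := by
      rw [hker]
      exact Subgroup.le_topologicalClosure _ (Subgroup.subset_normalClosure rfl)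
    rwa [MonoidHom.mem_ker, map_demushkinLikeWord, show π ∘ FreeProP.of = σ from funext hπ] at h
  obtain ⟨Φ, hΦ, hΦo⟩ := hrel.exists_lift (Heisenberg.card_zmod p)
    (Heisenberg.generators (ZMod p) I)
    ((Set.finite_range (Sum.inl : Fin 2 → Fin 2 ⊕ I)).subset (by
      rintro (j | i) h
      · exact ⟨j, rfl⟩
      · exact (h rfl).elim))
    (fun ψ hψ => by
      rw [map_demushkinLikeWord, show ψ ∘ FreeProP.of = _ from funext hψ,
        Heisenberg.demushkinLikeWord_generators p hf₂ hq])
  -- Since `Φ` has open kernel, it is trivial on the automorphisms fixing some finite subextension;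
  -- this is the finiteness needed for Hilbert 90.
  obtain ⟨E, hEfin, hE⟩ : ∃ E : IntermediateField F (AlgebraicClosure F), FiniteDimensional F E ∧
      ∀ g, (∀ x ∈ E, ρ g x = x) → Φ g = 1 := by
    have hopen : IsOpen (e.symm ⁻¹' (Φ.ker : Set Γ)) := hΦo.preimage e.symm.continuous_toFun
    have hmem := hopen.mem_nhds (x := 1) (by simp)
    obtain ⟨E, hEfin, hE⟩ := (krullTopology_mem_nhds_one_iff F (AlgebraicClosure F) _).1 hmem
    refine ⟨E, hEfin, fun g hg => ?_⟩
    have h : e g ∈ e.symm ⁻¹' (Φ.ker : Set Γ) :=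
      hE ((IntermediateField.mem_fixingSubgroup_iff E (ρ g)).2 hg)
    rw [Set.mem_preimage, e.symm_apply_apply] at h
    exact h
  set H := ((Heisenberg.fstHom (ZMod p)).comp Φ).ker with hH
  have hχ : ∀ g h : H, (Φ (g * h : H)).corner = (Φ g).corner + (Φ h).corner := by
    intro g h
    have hg : (Φ g).fst = 0 := g.2
    rw [Subgroup.coe_mul, map_mul, Heisenberg.corner_mul, hg, zero_mul, add_zero]
  have hEχ : ∀ h : H, (∀ x ∈ E, ρ h x = x) → (Φ h).corner = 0 := fun h hh => by
    rw [hE h hh, Heisenberg.corner_one]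
  obtain ⟨θ, c, hθ, hc, hcχ⟩ : ∃ (θ : Γ →* ZMod (p ^ 2)) (c : H → ZMod (p ^ 2)),
      (∀ g, redModSq p (θ g) = 1) ∧ IsTwistedHom (θ.comp H.subtype) c ∧
        ∀ h : H, redModSq p (c h) = (Φ h).corner := by
    by_cases hpΩ : (p : AlgebraicClosure F) = 0
    · have : CharP (AlgebraicClosure F) p :=
        ringChar.of_eq (CharP.ringChar_of_prime_eq_zero hp hpΩ)
      exact exists_lift_of_charP ρ H _ hχ E hEχ
    · exact exists_lift_of_natCast_ne_zero hpΩ ρ (fun g ω => fixes_rootsOfUnity hΓ hpΩ hρ g) H _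
        hχ E hEχ
  exact false_of_lift hfp' hq hword hΦ hθ hc hcχ
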